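/- All varieties are over $\mathbb C$. An algebraic semigroup law on a variety $X$ is an associative morphism $X\times X\to X$. An algebraic semigroup law $\mu$ on a smooth projective surface $S$ is called non-trivial if there are a complete curve $C$ (an integral proper scheme of dimension one over $\mathbb C$), a morphism $\pi:S\to C$ with a section $\sigma:C\to S$ (so $\pi\circ\sigma=\mathrm{id}_C$), and a law $\nu$ on $C$ which is either the group law of an elliptic curve structure on $C$, or $\nu(x_1,x_2)=x_1$, or $\nu(x_1,x_2)=x_2$, such that $$\mu(s_1,s_2)=\sigma\bigl(\nu(\pi(s_1),\pi(s_2))\bigr).$$ Let $S$ be a smooth projective surface with a non-trivial algebraic semigroup law $\mu$ given by such a formula with data $(C,\pi,\sigma,\nu)$. Let $\varphi:S\to\tilde S$ be the blowing-down of an exceptional curve $E$ on $S$ (a rational curve with $E^2=-1$), that is, $\tilde S$ is a smooth projective surface and $\varphi$ is the blow-up of $\tilde S$ at a closed point $p$, with $E=\varphi^{-1}(p)$. Assume that $\pi(E)$ is a point. Then there exists a unique non-trivial algebraic semigroup law $\tilde\mu$ on $\tilde S$ such that $\varphi:(S,\mu)\to(\tilde S,\tilde\mu)$ is a homomorphism,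 that is, $\varphi\circ\mu=\tilde\mu\circ(\varphi\times\varphi)$. -/

import Mathlib

open CategoryTheory MonoidalCategory CartesianMonoidalCategory AlgebraicGeometry

noncomputable section

namespace AlgSemigroup

attribute [local instance] MvPolynomial.gradedAlgebra

/-- The base scheme `Spec ℂ`. -/
abbrev SpecC : Scheme.{0} := Spec (CommRingCat.of ℂ)

/-- Projective space `ℙⁿ = Proj ℂ[x₀, …, xₙ]` as a scheme over `ℂ`. -/
def projectiveSpace (n : ℕ) : Over SpecC :=
  Over.mk (Y := Proj (MvPolynomial.homogeneousSubmodule (Fin (n + 1)) ℂ))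
    (Proj.toSpecZero (MvPolynomial.homogeneousSubmodule (Fin (n + 1)) ℂ) ≫
      Spec.map (CommRingCat.ofHom
        (algebraMap ℂ (MvPolynomial.homogeneousSubmodule (Fin (n + 1)) ℂ 0))))

/-- `X` is projective over `ℂ`: it is a closed subscheme of some `ℙⁿ`, over `ℂ`. -/
def IsProjective (X : Over SpecC) : Prop :=
  ∃ (n : ℕ) (i : X ⟶ projectiveSpace n), IsClosedImmersion i.left

/-- A smooth projective surface: a smooth projective variety (integral scheme) over `ℂ`
of dimension two. -/
structure IsSmoothProjectiveSurface (S : Over SpecC) : Prop where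
  integral : IsIntegral S.left
  smooth : Smooth S.hom
  projective : IsProjective S
  dim : topologicalKrullDim S.left = 2

/-- A complete curve: a complete variety (proper integral scheme) over `ℂ` of dimension one. -/
structure IsCompleteCurve (C : Over SpecC) : Prop where
  integral : IsIntegral C.left
  proper : IsProper C.hom
  dim : topologicalKrullDim C.left = 1

/-- A morphism `μ : X × X ⟶ X` over `ℂ` is an algebraic semigroup law if it is associative. -/
def IsSemigroupLaw {X : Over SpecC} (μ : X ⊗ X ⟶ X) : Prop :=
  (μ ▷ X) ≫ μ = (α_ X X X).hom ≫ (X ◁ μ) ≫ μ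

/-- A morphism `f : X ⟶ Y` is a homomorphism from `(X, μ)` to `(Y, ν)`. -/
def IsSemigroupHom {X Y : Over SpecC} (μ : X ⊗ X ⟶ X) (ν : Y ⊗ Y ⟶ Y) (f : X ⟶ Y) : Prop :=
  μ ≫ f = (f ⊗ₘ f) ≫ ν

/-- The laws on a complete curve `C` from which the non-trivial laws are built:
the group law of an elliptic curve (a one-dimensional abelian variety: a complete curve which is
a group scheme over `ℂ`), `(x₁, x₂) ↦ x₁`, or `(x₁, x₂) ↦ x₂`. -/
def IsBasicLaw {C : Over SpecC} (ν : C ⊗ C ⟶ C) : Prop :=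
  (∃ G : GrpObj C, G.mul = ν) ∨ ν = fst C C ∨ ν = snd C C

/-- The law `μ` on `S` is given by the formula `μ (s₁, s₂) = σ (ν (π s₁, π s₂))`, where
`π : S ⟶ C` is a morphism to a complete curve, `σ` is a section of `π`, and `ν` is one of the
three kinds of laws on `C` above. We call `π` the associated contraction. -/
structure IsNontrivialLawVia {S C : Over SpecC} (μ : S ⊗ S ⟶ S)
    (π : S ⟶ C) (σ : C ⟶ S) (ν : C ⊗ C ⟶ C) : Prop where
  curve : IsCompleteCurve C
  isSection : σ ≫ π = 𝟙 C
  basic : IsBasicLaw ν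
  law : μ = (π ⊗ₘ π) ≫ ν ≫ σ

/-- A non-trivial algebraic semigroup law on `S`. -/
def IsNontrivialSemigroupLaw {S : Over SpecC} (μ : S ⊗ S ⟶ S) : Prop :=
  IsSemigroupLaw μ ∧
    ∃ (C : Over SpecC) (π : S ⟶ C) (σ : C ⟶ S) (ν : C ⊗ C ⟶ C), IsNontrivialLawVia μ π σ ν

/-- An ideal sheaf is that of an effective Cartier divisor: locally it is generated by one
nonzerodivisor. -/
def IsEffectiveCartier {X : Scheme.{0}} (I : X.IdealSheafData) : Prop :=
  ∀ x : X, ∃ U : X.affineOpens, x ∈ U.1 ∧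
    ∃ a ∈ nonZeroDivisors Γ(X, U.1), I.ideal U = Ideal.span {a}

/-- `f : X ⟶ Y` is the blow-up of `Y` along the ideal sheaf `I`: the inverse image ideal sheaf of
`I` is that of an effective Cartier divisor, and `f` is universal with this property. -/
def IsBlowUp {X Y : Scheme.{0}} (f : X ⟶ Y) (I : Y.IdealSheafData) : Prop :=
  IsEffectiveCartier (I.comap f) ∧
    ∀ (T : Scheme.{0}) (g : T ⟶ Y), IsEffectiveCartier (I.comap g) → ∃! h : T ⟶ X, h ≫ f = g

/-- `φ : S ⟶ T` is the blowing-down of the exceptional curve `E` on the smooth projective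
surface `S` (which is assumed separately): `T` is a smooth projective surface and `φ` is the
blow-up of `T` at a closed point `p` (with its reduced structure), whose exceptional curve
is `E = φ⁻¹(p)`. -/
structure IsBlowingDown {S T : Over SpecC} (φ : S ⟶ T) (E : Set S.left) : Prop where
  target : IsSmoothProjectiveSurface T
  blowUp : ∃ (p : T.left) (hp : IsClosed ({p} : Set T.left)),
    IsBlowUp φ.left (Scheme.IdealSheafData.vanishingIdeal ⟨{p}, hp⟩) ∧ E = φ.left ⁻¹' {p}

end AlgSemigroup

end

-- The contraction `π` is constant on every fibre of `φ`: the fibre over `p` is `E`, contracted by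
-- assumption, and the others are single points because a blow-up is an isomorphism away from its
-- centre (`IsBlowUp.exists_section`). As `φ` is proper and birational and the smooth surface below
-- is normal, functions upstairs descend (`isIso_app_of_isIntegrallyClosed`), so `π` factors as `φ ≫
-- π'` by rigidity (`exists_comp_eq_of_constant_on_fibres`). Then `σ ≫ φ` is a section of `π'`, and
-- the same formula with data `(π', σ ≫ φ, ν)` is the required law. It is unique because `φ × φ` is
-- scheme-theoretically dominant and the target is separated.
--
-- Normality comes from smoothness, since a smooth algebra is locally étale over a polynomial ring.

universe u

/-! ### Normality of smooth algebras -/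

namespace AlgSemigroup

open scoped TensorProduct

/-- Let `A` be an integrally closed domain contained in a domain `B`. An element of `B` which is
integral over `A` and has a nonzero multiple by an element of `A` in `A` lies in `A`. -/
lemma mem_range_of_isIntegral_of_mul_mem {A B : Type*} [CommRing A] [IsDomain A]
    [IsIntegrallyClosed A] [CommRing B] [IsDomain B] [Algebra A B]
    (hinj : Function.Injective (algebraMap A B)) {a d : A} {b : B} (ha : a ≠ 0)
    (hb : IsIntegral A b) (h : algebraMap A B a * b = algebraMap A B d) :
    b ∈ (algebraMap A B).range := by
  let K := FractionRing A
  let L := FractionRing B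
  have hAL : Function.Injective (algebraMap A L) := by
    rw [IsScalarTower.algebraMap_eq A B L]
    exact (IsFractionRing.injective B L).comp hinj
  have : FaithfulSMul A L := (faithfulSMul_iff_algebraMap_injective A L).mpr hAL
  let i : K →ₐ[A] L := IsFractionRing.liftAlgHom (g := Algebra.ofId A L) hAL
  have ha' : algebraMap A K a ≠ 0 := by simpa using ha
  -- The relation `a b = d` identifies `b` with the fraction `d / a` of `A`, which is then integral
  -- over `A`.
  let x : K := algebraMap A K d / algebraMap A K a
  have hx : i x = algebraMap B L b := by
    have haL : algebraMap A L a ≠ 0 := by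
      intro h0; exact ha (hAL (by simpa using h0))
    simp only [x, map_div₀, AlgHom.commutes]
    rw [div_eq_iff haL, IsScalarTower.algebraMap_apply A B L, IsScalarTower.algebraMap_apply A B L,
      ← h, map_mul, mul_comm]
  have hxi : IsIntegral A x := by
    rw [← isIntegral_algHom_iff i i.toRingHom.injective, hx]
    exact hb.algebraMap
  obtain ⟨y, hy⟩ := IsIntegrallyClosed.isIntegral_iff.mp hxi
  refine ⟨y, IsFractionRing.injective B L ?_⟩
  rw [← hx, ← hy, AlgHom.commutes, ← IsScalarTower.algebraMap_apply]

/-- An étale algebra over an integrally closed domain which is a domain is integrally closed. -/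
lemma isIntegrallyClosed_of_etale (R A : Type*) [CommRing R] [IsDomain R] [IsIntegrallyClosed R]
    [CommRing A] [IsDomain A] [Algebra R A] [Algebra.Etale R A] : IsIntegrallyClosed A := by
  let K := FractionRing R
  let M := Algebra.algebraMapSubmonoid A (nonZeroDivisors R)
  have hM : M ≤ nonZeroDivisors A := by
    rintro _ ⟨r, hr, rfl⟩
    have : r ≠ 0 := nonZeroDivisors.ne_zero hr
    exact mem_nonZeroDivisors_of_ne_zero (by simpa using this)
  let T := A ⊗[R] K
  have : IsLocalization M T := inferInstance
  have : IsDomain T := IsLocalization.isDomain_of_le_nonZeroDivisors _ hM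
  have : IsDomain (K ⊗[R] A) := (Algebra.TensorProduct.comm R K A).toMulEquiv.isDomain _
  have : Module.Finite K (K ⊗[R] A) := Algebra.FormallyUnramified.finite_of_free K (K ⊗[R] A)
  -- The generic fibre `A ⊗ K` is a domain finite over the field `K`, hence a field, and so the
  -- fraction field of `A`.
  have hT : IsField T := (Algebra.TensorProduct.comm R A K).toMulEquiv.isField
    (isField_of_isIntegral_of_isField' (R := K) (Field.toIsField K))
  let : Field T := hT.toField
  have hTinj : Function.Injective (algebraMap A T) := IsLocalization.injective T hM
  have : IsFractionRing A T := by
    have : FaithfulSMul A T := (faithfulSMul_iff_algebraMap_injective A T).mpr hTinj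
    refine IsFractionRing.of_field _ _ fun z ↦ ?_
    obtain ⟨x, y, rfl⟩ := IsLocalization.exists_mk'_eq M z
    exact ⟨x, y, by
      rw [eq_comm, div_eq_iff, IsLocalization.mk'_spec]
      simpa using nonZeroDivisors.ne_zero (hM y.2)⟩
  refine (isIntegrallyClosed_iff T).mpr fun {x} hx ↦ ?_
  -- Integral closure commutes with smooth base change, so that of `A` in `A ⊗ K` comes from that of
  -- `R` in `K`, which is `R`.
  obtain ⟨y, hy⟩ := (TensorProduct.toIntegralClosure_bijective_of_smooth (R := R) (S := A)
    (B := K)).2 ⟨x, hx⟩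
  replace hy := congr(($hy).1)
  dsimp [TensorProduct.toIntegralClosure] at hy
  rw [← hy]
  clear hy
  induction y with
  | zero => exact ⟨0, by simp⟩
  | add y z hy hz =>
    obtain ⟨a, ha⟩ := hy
    obtain ⟨b, hb⟩ := hz
    exact ⟨a + b, by rw [map_add, ha, hb, map_add]⟩
  | tmul a k =>
    obtain ⟨k, hk⟩ := k
    obtain ⟨r, rfl⟩ := IsIntegrallyClosed.isIntegral_iff.mp hk
    refine ⟨r • a, ?_⟩
    change (r • a) ⊗ₜ[R] (1 : K) = a ⊗ₜ algebraMap R K r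
    rw [Algebra.algebraMap_eq_smul_one, TensorProduct.smul_tmul]

/-- A domain which is smooth over a field is integrally closed. -/
lemma isIntegrallyClosed_of_smooth (k A : Type*) [Field k] [CommRing A] [IsDomain A] [Algebra k A]
    [Algebra.Smooth k A] : IsIntegrallyClosed A := by
  refine .of_localization_maximal fun P _ hP ↦ ?_
  obtain ⟨f, hf, n, _, _, _⟩ :=
    Algebra.IsSmoothAt.exists_isStandardEtale_mvPolynomial (R := k) (p := P)
  have hf0 : f ≠ 0 := by rintro rfl; exact hf (zero_mem _)
  have hfM : Submonoid.powers f ≤ P.primeCompl := by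
    rw [Submonoid.powers_le]; exact hf
  have : IsDomain (Localization.Away f) :=
    IsLocalization.isDomain_localization (powers_le_nonZeroDivisors_of_noZeroDivisors hf0)
  have : IsIntegrallyClosed (Localization.Away f) :=
    isIntegrallyClosed_of_etale (MvPolynomial (Fin n) k) _
  let := IsLocalization.localizationAlgebraOfSubmonoidLe (Localization.Away f)
    (Localization.AtPrime P) _ _ hfM
  have := IsLocalization.localization_isScalarTower_of_submonoid_le (Localization.Away f)
    (Localization.AtPrime P) _ _ hfM
  have := IsLocalization.isLocalization_of_submonoid_le (Localization.Away f)
    (Localization.AtPrime P) _ _ hfM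
  refine isIntegrallyClosed_of_isLocalization (R := Localization.Away f) _
    (P.primeCompl.map (algebraMap A (Localization.Away f))) ?_
  rintro _ ⟨r, hr, rfl⟩
  refine mem_nonZeroDivisors_of_ne_zero fun h ↦ hr ?_
  rw [(IsLocalization.injective (Localization.Away f)
    (powers_le_nonZeroDivisors_of_noZeroDivisors hf0)) (h.trans (map_zero _).symm)]
  exact zero_mem _

end AlgSemigroup

/-! ### Descent of morphisms along dominant morphisms -/

namespace AlgSemigroup

open Limits in
/-- Morphisms to a separated scheme which agree after a scheme-theoretically dominant morphism
are equal. -/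
lemma ext_of_isSchemeTheoreticallyDominant {W X Y : Scheme.{u}} [Y.IsSeparated] (i : W ⟶ X)
    [IsSchemeTheoreticallyDominant i] {f g : X ⟶ Y} (h : i ≫ f = i ≫ g) : f = g := by
  have hk : (equalizer.ι f g).ker = ⊥ := by
    rw [eq_bot_iff, ← i.ker_eq_bot, ← equalizer.lift_ι i h]
    exact Scheme.Hom.le_ker_comp _ _
  have := IsClosedImmersion.isIso_iff_ker_eq_bot.mpr hk
  rw [← cancel_epi (equalizer.ι f g)]
  exact equalizer.condition f g

open Limits in
/-- A scheme which is separated over an affine scheme is separated. -/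
lemma isSeparated_of_hom {X Y : Scheme.{u}} [Y.IsSeparated] (f : X ⟶ Y) [IsSeparated f] :
    X.IsSeparated := by
  refine ⟨?_⟩
  rw [← terminal.comp_from f]
  infer_instance

/-- Morphisms to an affine scheme extend along morphisms which are isomorphisms on global
sections. -/
lemma exists_comp_eq_of_isIso_appTop {X Y Z : Scheme.{u}} [IsAffine Y] [IsAffine Z]
    (f : X ⟶ Y) [IsIso f.appTop] (g : X ⟶ Z) : ∃ h : Y ⟶ Z, f ≫ h = g := by
  refine ⟨Y.toSpecΓ ≫ inv (Spec.map f.appTop) ≫ Spec.map g.appTop ≫ inv Z.toSpecΓ, ?_⟩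
  rw [Scheme.toSpecΓ_naturality_assoc, IsIso.hom_inv_id_assoc, ← Scheme.toSpecΓ_naturality_assoc,
    IsIso.hom_inv_id, Category.comp_id]

open Limits in
/-- Factoring a morphism to a separated scheme through a scheme-theoretically dominant morphism
is local on the target of the latter. -/
lemma exists_comp_eq_of_locally {X Y Z : Scheme.{u}} [Z.IsSeparated] (f : X ⟶ Y)
    [QuasiCompact f] [IsSchemeTheoreticallyDominant f] (g : X ⟶ Z)
    (H : ∀ y : Y, ∃ V : Y.Opens, y ∈ V ∧ ∃ h : V.toScheme ⟶ Z,
      (f ∣_ V) ≫ h = (f ⁻¹ᵁ V).ι ≫ g) :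
    ∃ h : Y ⟶ Z, f ≫ h = g := by
  choose V hV h hh using H
  have key {T : Scheme.{u}} (y : Y) (a : T ⟶ X) (b : T ⟶ V y) (e : a ≫ f = b ≫ (V y).ι) :
      a ≫ g = b ≫ h y := by
    let l := (isPullback_morphismRestrict f (V y)).lift b a e.symm
    have h1 : l ≫ (f ⁻¹ᵁ V y).ι = a := (isPullback_morphismRestrict f (V y)).lift_snd ..
    have h2 : l ≫ (f ∣_ V y) = b := (isPullback_morphismRestrict f (V y)).lift_fst ..
    rw [← h1, ← h2, Category.assoc, Category.assoc, hh]
  let 𝒰 : Y.OpenCover := Y.openCoverOfIsOpenCover V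
    (TopologicalSpace.IsOpenCover.mk (eq_top_iff.mpr fun y _ ↦
      TopologicalSpace.Opens.mem_iSup.mpr ⟨y, hV y⟩))
  let π' : Y ⟶ Z := 𝒰.glueMorphisms h fun y z ↦ by
    let u := pullback.fst (𝒰.f y) (𝒰.f z) ≫ 𝒰.f y
    have hu : u = pullback.snd (𝒰.f y) (𝒰.f z) ≫ 𝒰.f z := pullback.condition
    -- The overlap maps to `Y` by an open immersion, hence flatly, and flat base change preserves
    -- dominance of the quasi-compact `f`.
    have : IsSchemeTheoreticallyDominant (pullback.snd f u) := inferInstance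
    refine ext_of_isSchemeTheoreticallyDominant (pullback.snd f u) ?_
    have h1 := key y (pullback.fst f u) (pullback.snd f u ≫ pullback.fst (𝒰.f y) (𝒰.f z))
      (pullback.condition.trans (Category.assoc _ _ _).symm)
    have h2 := key z (pullback.fst f u) (pullback.snd f u ≫ pullback.snd (𝒰.f y) (𝒰.f z))
      (pullback.condition.trans ((congrArg _ hu).trans (Category.assoc _ _ _).symm))
    exact (Category.assoc _ _ _).symm.trans ((h1.symm.trans h2).trans (Category.assoc _ _ _))
  refine ⟨π', ?_⟩
  refine Scheme.Cover.hom_ext (𝒰.pullback₁ f) _ _ fun y ↦ ?_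
  refine Eq.trans ?_ (key y (pullback.fst f (𝒰.f y)) (pullback.snd f (𝒰.f y))
    pullback.condition).symm
  change pullback.fst f (𝒰.f y) ≫ f ≫ π' = _
  rw [pullback.condition_assoc]
  congr 1
  exact Scheme.Cover.ι_glueMorphisms 𝒰 h _ y

/-! ### Sections of proper birational morphisms, and rigidity -/

lemma isIso_app_of_le {X Y : Scheme.{u}} (f : X ⟶ Y) (D B : Y.Opens) (h : B ≤ D)
    [IsIso (f ∣_ D)] : IsIso (f.app B) := by
  -- The opens from `morphismRestrict_app'` equal `B` and its preimage only propositionally; keeping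
  -- them variable permits `subst`.
  have key (B' : Y.Opens) (W : X.Opens) (e : W ≤ f ⁻¹ᵁ B') (hB : B' = B) (hW : W = f ⁻¹ᵁ B')
      (H : IsIso (f.appLE B' W e)) : IsIso (f.app B) := by
    subst hB hW
    simpa [Scheme.Hom.appLE] using H
  refine key _ _ (image_morphismRestrict_preimage f D (D.ι ⁻¹ᵁ B)).le
    (by simpa [Scheme.Hom.image_preimage_eq_opensRange_inf] using h)
    (image_morphismRestrict_preimage f D (D.ι ⁻¹ᵁ B)) ?_
  rw [← morphismRestrict_app']
  exact (inferInstance : IsIso ((f ∣_ D).app (D.ι ⁻¹ᵁ B)))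

lemma isIso_appTop_morphismRestrict {X Y : Scheme.{u}} (f : X ⟶ Y) (V : Y.Opens)
    [IsIso (f.app V)] : IsIso (f ∣_ V).appTop := by
  have key (B : Y.Opens) (W : X.Opens) (e : W ≤ f ⁻¹ᵁ B) (hB : B = V) (hW : W = f ⁻¹ᵁ B) :
      IsIso (f.appLE B W e) := by
    subst hB hW
    simpa [Scheme.Hom.appLE]
  have := key _ _ (image_morphismRestrict_preimage f V ⊤).le (by simp)
    (image_morphismRestrict_preimage f V ⊤)
  rwa [← morphismRestrict_app'] at this

/-- Sections of a universally closed morphism over affine opens are integral. -/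
lemma isIntegral_app_of_universallyClosed {X Y : Scheme.{u}} (f : X ⟶ Y) [UniversallyClosed f]
    (V : Y.Opens) (hV : IsAffineOpen V) : (f.app V).hom.IsIntegral := by
  have key (B' : Y.Opens) (W : X.Opens) (e : W ≤ f ⁻¹ᵁ B') (hB : B' = V) (hW : W = f ⁻¹ᵁ B')
      (H : (f.appLE B' W e).hom.IsIntegral) : (f.app V).hom.IsIntegral := by
    subst hB hW
    simpa [Scheme.Hom.appLE] using H
  refine key _ _ (image_morphismRestrict_preimage f V ⊤).le (by simp)
    (image_morphismRestrict_preimage f V ⊤) ?_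
  rw [← morphismRestrict_app']
  have : IsAffine V := hV
  exact isIntegral_appTop_of_universallyClosed (f ∣_ V)

/-- A proper birational morphism of integral schemes induces isomorphisms on sections over
normal affine opens. -/
lemma isIso_app_of_isIntegrallyClosed {X Y : Scheme.{u}} [IsIntegral X] [IsIntegral Y]
    (f : X ⟶ Y) [IsProper f] [IsDominant f] (D : Y.Opens) (hD : (D : Set Y).Nonempty)
    [IsIso (f ∣_ D)] (V : Y.Opens) (hV : IsAffineOpen V) (hVn : (V : Set Y).Nonempty)
    (hn : ∀ [IsDomain Γ(Y, V)], IsIntegrallyClosed Γ(Y, V)) : IsIso (f.app V) := by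
  have : Nonempty V := hVn.to_subtype
  have hfV : (f ⁻¹ᵁ V : Set X).Nonempty := f.denseRange.exists_mem_open V.isOpen hVn
  have : Nonempty (f ⁻¹ᵁ V) := hfV.to_subtype
  have : IsIntegrallyClosed Γ(Y, V) := hn
  have : IsSchemeTheoreticallyDominant f := .of_isDominant f
  have hinj := f.app_injective V
  -- a nonzero function vanishing outside of `D`
  obtain ⟨y, hyD, hyV⟩ : ((D : Set Y) ∩ V).Nonempty :=
    nonempty_preirreducible_inter D.isOpen V.isOpen hD hVn
  obtain ⟨a, haD, hya⟩ := hV.exists_basicOpen_le ⟨y, hyD⟩ hyV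
  have ha : a ≠ 0 := by
    rintro rfl
    simp at hya
  let B := Y.basicOpen a
  have hB : IsIso (f.app B) := isIso_app_of_le f D B haD
  rw [ConcreteCategory.isIso_iff_bijective]
  refine ⟨hinj, fun b ↦ ?_⟩
  have hint := isIntegral_app_of_universallyClosed f V hV
  algebraize [(f.app V).hom]
  -- Over the basic open of `a` the map `f` is an isomorphism, so there `b` comes from a section
  -- whose denominator is a power of `a`.
  have hex : ∃ (n : ℕ) (d : Γ(Y, V)), f.app V (a ^ n) * b = f.app V d := by
    have := hV.isLocalization_basicOpen a
    have hBV : B ≤ V := Y.basicOpen_le a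
    let i : f ⁻¹ᵁ B ⟶ f ⁻¹ᵁ V := homOfLE (f.preimage_mono hBV)
    obtain ⟨c, hc⟩ := ((ConcreteCategory.isIso_iff_bijective (f.app B)).mp hB).2
      (X.presheaf.map i.op b)
    obtain ⟨n, d, hd⟩ := IsLocalization.Away.surj a c
    refine ⟨n, d, ?_⟩
    have hfB : (f ⁻¹ᵁ B : Set X).Nonempty := f.denseRange.exists_mem_open B.isOpen ⟨y, hya⟩
    have : Nonempty (f ⁻¹ᵁ B) := hfB.to_subtype
    refine map_injective_of_isIntegral X i ?_
    have nat (t : Γ(Y, V)) : X.presheaf.map i.op (f.app V t) =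
        f.app B (Y.presheaf.map (homOfLE hBV).op t) :=
      congr($(f.naturality (homOfLE hBV).op) t).symm
    rw [map_mul, nat, nat, ← hc, ← map_mul, mul_comm, map_pow]
    exact congrArg _ hd
  obtain ⟨n, d, hd⟩ := hex
  obtain ⟨c, hc⟩ := mem_range_of_isIntegral_of_mul_mem (A := Γ(Y, V)) (B := Γ(X, f ⁻¹ᵁ V))
    hinj (pow_ne_zero n ha) (hint b) hd
  exact ⟨c, hc⟩

/-- A morphism from an integral scheme which is constant on the fibres of a proper birational
morphism to a normal scheme factors through the latter. -/
theorem exists_comp_eq_of_constant_on_fibres {X Y Z : Scheme.{u}} [IsIntegral X] [IsIntegral Y]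
    [Z.IsSeparated] (f : X ⟶ Y) [IsProper f] [IsDominant f] (D : Y.Opens)
    (hD : (D : Set Y).Nonempty) [IsIso (f ∣_ D)]
    (hn : ∀ V : Y.Opens, IsAffineOpen V → ∀ [IsDomain Γ(Y, V)], IsIntegrallyClosed Γ(Y, V))
    (g : X ⟶ Z) (hg : ∀ y, ∃ z, ∀ x, f x = y → g x = z) : ∃ h : Y ⟶ Z, f ≫ h = g := by
  have : IsSchemeTheoreticallyDominant f := .of_isDominant f
  refine exists_comp_eq_of_locally f g fun y ↦ ?_
  obtain ⟨z, hz⟩ := hg y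
  obtain ⟨_, ⟨U, hU, rfl⟩, hzU, -⟩ :=
    Z.isBasis_affineOpens.exists_subset_of_mem_open (Set.mem_univ z) isOpen_univ
  -- The points whose whole fibre is sent into `U`; this set is open because `f` is closed.
  let V₀ : Y.Opens := ⟨(f '' (g ⁻¹ᵁ U : Set X)ᶜ)ᶜ,
    (f.isClosedMap _ (g ⁻¹ᵁ U).isOpen.isClosed_compl).isOpen_compl⟩
  have hy : y ∈ V₀ := by
    rintro ⟨x, hx, rfl⟩
    exact hx (show g x ∈ U from hz x rfl ▸ hzU)
  obtain ⟨_, ⟨V, hV, rfl⟩, hyV, hVV₀ : V ≤ V₀⟩ :=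
    Y.isBasis_affineOpens.exists_subset_of_mem_open hy V₀.isOpen
  have hVU : f ⁻¹ᵁ V ≤ g ⁻¹ᵁ U := by
    intro x hx
    by_contra hxU
    exact hVV₀ hx ⟨x, hxU, rfl⟩
  have : IsAffine V := hV
  have : IsAffine U := hU
  have : IsIso (f.app V) := isIso_app_of_isIntegrallyClosed f D hD V hV ⟨y, hyV⟩ (hn V hV)
  have := isIso_appTop_morphismRestrict f V
  obtain ⟨h, hh⟩ := exists_comp_eq_of_isIso_appTop (f ∣_ V) (g.resLE U (f ⁻¹ᵁ V) hVU)
  exact ⟨V, hyV, h ≫ Scheme.Opens.ι U, by rw [reassoc_of% hh, Scheme.Hom.resLE_comp_ι]⟩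

/-! ### Blow-ups away from the centre -/

/-- The blow-up along an ideal sheaf has a section over any open on which the ideal sheaf is
trivial, and is an isomorphism there. -/
lemma IsBlowUp.exists_section {X Y : Scheme.{0}} {f : X ⟶ Y} {I : Y.IdealSheafData}
    (hf : IsBlowUp f I) (U : Y.Opens) (hU : ∀ y ∈ U, y ∉ I.support) :
    IsIso (f ∣_ U) ∧ ∃ s : U.toScheme ⟶ X, (f ∣_ U) ≫ s = (f ⁻¹ᵁ U).ι := by
  have cartier {T : Scheme.{0}} (g : T ⟶ Y) (hg : ∀ t, g t ∈ U) :
      IsEffectiveCartier (I.comap g) := by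
    have : I.comap g = ⊤ := by
      rw [← Scheme.IdealSheafData.support_eq_bot_iff, Scheme.IdealSheafData.support_comap]
      ext t
      simpa using hU _ (hg t)
    intro t
    obtain ⟨_, ⟨W, hW, rfl⟩, htW, -⟩ :=
      T.isBasis_affineOpens.exists_subset_of_mem_open (Set.mem_univ t) isOpen_univ
    exact ⟨⟨W, hW⟩, htW, 1, one_mem _, by simp [this]⟩
  obtain ⟨s, hs, -⟩ := hf.2 U U.ι (cartier _ fun t ↦ t.2)
  have hs' : (f ∣_ U) ≫ s = (f ⁻¹ᵁ U).ι :=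
    (hf.2 (f ⁻¹ᵁ U) ((f ⁻¹ᵁ U).ι ≫ f) (cartier _ fun t ↦ t.2)).unique
      (by rw [Category.assoc, hs, morphismRestrict_ι]) rfl
  have hr : Set.range s ⊆ Set.range (f ⁻¹ᵁ U).ι := by
    rintro _ ⟨t, rfl⟩
    simp only [Scheme.Opens.range_ι]
    change f (s t) ∈ U
    rw [← Scheme.Hom.comp_apply, hs]
    exact t.2
  refine ⟨⟨IsOpenImmersion.lift (f ⁻¹ᵁ U).ι s hr, ?_, ?_⟩, s, hs'⟩
  · rw [← cancel_mono (f ⁻¹ᵁ U).ι, Category.assoc, IsOpenImmersion.lift_fac, hs', Category.id_comp]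
  · rw [← cancel_mono U.ι, Category.assoc, morphismRestrict_ι, IsOpenImmersion.lift_fac_assoc, hs,
      Category.id_comp]

-- Properness and normality of smooth projective surfaces

attribute [local instance] MvPolynomial.gradedAlgebra

lemma bijective_algebraMap_homogeneousSubmodule_zero (n : ℕ) :
    Function.Bijective (algebraMap ℂ (MvPolynomial.homogeneousSubmodule (Fin (n + 1)) ℂ 0)) := by
  refine ⟨fun a b h ↦ MvPolynomial.C_injective (Fin (n + 1)) ℂ congr(($h).1), fun ⟨x, hx⟩ ↦ ?_⟩
  refine ⟨x.coeff 0, Subtype.ext ?_⟩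
  exact (MvPolynomial.totalDegree_eq_zero_iff_eq_C.mp
    (Nat.le_zero.mp ((MvPolynomial.mem_homogeneousSubmodule _ _).mp hx).totalDegree_le)).symm

instance isProper_projectiveSpace (n : ℕ) : IsProper (projectiveSpace n).hom := by
  have : IsScalarTower ℂ (MvPolynomial.homogeneousSubmodule (Fin (n + 1)) ℂ 0)
      (MvPolynomial (Fin (n + 1)) ℂ) := ⟨fun r x y ↦ smul_mul_assoc r x.1 y⟩
  have : Algebra.FiniteType (MvPolynomial.homogeneousSubmodule (Fin (n + 1)) ℂ 0)
      (MvPolynomial (Fin (n + 1)) ℂ) := .of_restrictScalars_finiteType ℂ _ _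
  have : IsIso (CommRingCat.ofHom
      (algebraMap ℂ (MvPolynomial.homogeneousSubmodule (Fin (n + 1)) ℂ 0))) :=
    (ConcreteCategory.isIso_iff_bijective _).mpr
      (bijective_algebraMap_homogeneousSubmodule_zero n)
  dsimp [projectiveSpace]
  infer_instance

lemma IsProjective.isProper {X : Over SpecC} (hX : IsProjective X) : IsProper X.hom := by
  obtain ⟨n, i, _⟩ := hX
  rw [← Over.w i]
  infer_instance

/-- Affine opens of an integral scheme which is smooth over a field are normal. -/
lemma isIntegrallyClosed_of_smooth_hom {k : Type} [Field k] {X : Scheme.{0}}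
    (f : X ⟶ Spec (CommRingCat.of k)) [Smooth f] (V : X.Opens) (hV : IsAffineOpen V)
    [IsDomain Γ(X, V)] : IsIntegrallyClosed Γ(X, V) := by
  have h := f.smooth_appLE (isAffineOpen_top _) hV le_top
  have hk : IsField Γ(Spec (CommRingCat.of k), ⊤) :=
    (Scheme.ΓSpecIso (.of k)).commRingCatIsoToRingEquiv.toMulEquiv.isField (Field.toIsField k)
  let := hk.toField
  algebraize [(f.appLE ⊤ V le_top).hom]
  exact isIntegrallyClosed_of_smooth Γ(Spec (CommRingCat.of k), ⊤) Γ(X, V)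

lemma exists_ne_of_topologicalKrullDim {X : Type*} [TopologicalSpace X]
    (h : topologicalKrullDim X = 2) (p : X) : ∃ q, q ≠ p := by
  by_contra! H
  have : Subsingleton X := ⟨fun a b ↦ (H a).trans (H b).symm⟩
  have : topologicalKrullDim X ≤ 0 := topologicalKrullDim_zero_of_discreteTopology X
  rw [h] at this
  norm_num at this

/-! ### Products and semigroup laws -/

open Limits in
/-- The square of a quasi-compact scheme-theoretically dominant morphism of flat `B`-schemes is
scheme-theoretically dominant. -/
lemma isSchemeTheoreticallyDominant_tensorHom {B : Scheme.{0}} {X Y : Over B} (f : X ⟶ Y)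
    [Flat X.hom] [Flat Y.hom] [QuasiCompact f.left] [IsSchemeTheoreticallyDominant f.left] :
    IsSchemeTheoreticallyDominant (f ⊗ₘ f).left := by
  -- Both factors of `f ⊗ₘ f = (f ▷ X) ≫ (Y ◁ f)` are base changes of `f` along flat projections.
  have h1 : IsPullback (pullback.fst X.hom X.hom) (f ▷ X).left f.left
      (pullback.fst Y.hom X.hom) := by
    refine IsPullback.of_bot ?_ (Over.whiskerRight_left_fst f).symm
      (IsPullback.of_hasPullback Y.hom X.hom)
    rw [Over.whiskerRight_left_snd, Over.w]
    exact IsPullback.of_hasPullback X.hom X.hom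
  have h2 : IsPullback (pullback.snd Y.hom X.hom) (Y ◁ f).left f.left
      (pullback.snd Y.hom Y.hom) := by
    refine IsPullback.of_bot ?_ (Over.whiskerLeft_left_snd f).symm
      (IsPullback.of_hasPullback Y.hom Y.hom).flip
    rw [Over.whiskerLeft_left_fst, Over.w]
    exact (IsPullback.of_hasPullback Y.hom X.hom).flip
  have := IsSchemeTheoreticallyDominant.of_isPullback h1
  have := IsSchemeTheoreticallyDominant.of_isPullback h2
  rw [MonoidalCategory.tensorHom_def, Over.comp_left]
  infer_instance

lemma IsBasicLaw.assoc {C : Over SpecC} {ν : C ⊗ C ⟶ C} (h : IsBasicLaw ν) :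
    IsSemigroupLaw ν := by
  rcases h with ⟨G, rfl⟩ | rfl | rfl
  · exact MonObj.mul_assoc C
  · simp [IsSemigroupLaw]
  · simp [IsSemigroupLaw]

/-- Since `σ` is a section, `π` is a homomorphism from `μ` to `ν`; both triple products are then `σ`
of triple products in `C`. -/
lemma IsNontrivialLawVia.isSemigroupLaw {S C : Over SpecC} {μ : S ⊗ S ⟶ S} {π : S ⟶ C}
    {σ : C ⟶ S} {ν : C ⊗ C ⟶ C} (h : IsNontrivialLawVia μ π σ ν) : IsSemigroupLaw μ := by
  have hν : (ν ▷ C) ≫ ν = (α_ C C C).hom ≫ (C ◁ ν) ≫ ν := h.basic.assoc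
  have hμπ : μ ≫ π = (π ⊗ₘ π) ≫ ν := by rw [h.law]; simp [h.isSection]
  have h1 : (μ ▷ S) ≫ (π ⊗ₘ π) = ((π ⊗ₘ π) ⊗ₘ π) ≫ (ν ▷ C) := by
    rw [← tensorHom_id, ← tensorHom_id, tensorHom_comp_tensorHom, tensorHom_comp_tensorHom, hμπ,
      Category.id_comp, Category.comp_id]
  have h2 : (S ◁ μ) ≫ (π ⊗ₘ π) = (π ⊗ₘ (π ⊗ₘ π)) ≫ (C ◁ ν) := by
    rw [← id_tensorHom, ← id_tensorHom, tensorHom_comp_tensorHom, tensorHom_comp_tensorHom, hμπ,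
      Category.id_comp, Category.comp_id]
  unfold IsSemigroupLaw
  nth_rw 2 4 [h.law]
  rw [reassoc_of% h1, reassoc_of% hν, reassoc_of% h2]
  simp

lemma IsNontrivialLawVia.comp {S S' C : Over SpecC} {μ : S ⊗ S ⟶ S} {π : S ⟶ C}
    {σ : C ⟶ S} {ν : C ⊗ C ⟶ C} (h : IsNontrivialLawVia μ π σ ν) (φ : S ⟶ S') (π' : S' ⟶ C)
    (hπ' : φ ≫ π' = π) :
    IsNontrivialLawVia ((π' ⊗ₘ π') ≫ ν ≫ σ ≫ φ) π' (σ ≫ φ) ν where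
  curve := h.curve
  isSection := by rw [Category.assoc, hπ', h.isSection]
  basic := h.basic
  law := rfl

end AlgSemigroup

/-! ### The induced law on the blown-down surface -/

open AlgSemigroup in
theorem mainTheorem12
    (S S' C : Over AlgSemigroup.SpecC)
    (hS : AlgSemigroup.IsSmoothProjectiveSurface S)
    (μ : S ⊗ S ⟶ S) (π : S ⟶ C) (σ : C ⟶ S) (ν : C ⊗ C ⟶ C)
    (hμ : AlgSemigroup.IsNontrivialLawVia μ π σ ν)
    (φ : S ⟶ S') (E : Set S.left)
    (hφ : AlgSemigroup.IsBlowingDown φ E)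
    (hE : ∃ P : C.left, π.left '' E = {P}) :
    ∃! μ' : S' ⊗ S' ⟶ S',
      AlgSemigroup.IsNontrivialSemigroupLaw μ' ∧ AlgSemigroup.IsSemigroupHom μ μ' φ := by
  obtain ⟨hS', p, hp, hbl, rfl⟩ := hφ
  obtain ⟨P, hP⟩ := hE
  have := hS.integral
  have := hS'.integral
  have := hS.smooth
  have := hS'.smooth
  have := hS.projective.isProper
  have := hS'.projective.isProper
  have := hμ.curve.proper
  have : S'.left.IsSeparated := isSeparated_of_hom S'.hom
  have : C.left.IsSeparated := isSeparated_of_hom C.hom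
  have : IsProper (φ.left ≫ S'.hom) := by rwa [Over.w]
  have : IsProper φ.left := .of_comp _ S'.hom
  let D : S'.left.Opens := ⟨{p}ᶜ, hp.isOpen_compl⟩
  have hD : (D : Set S'.left).Nonempty := exists_ne_of_topologicalKrullDim hS'.dim p
  obtain ⟨_, s, hs⟩ := hbl.exists_section D fun y hy ↦ by
    rw [← SetLike.mem_coe, Scheme.IdealSheafData.coe_support_vanishingIdeal]
    exact hy
  have hsD (x : S.left) (hx : φ.left x ∈ D) : s ⟨φ.left x, hx⟩ = x := by
    let x' : (φ.left ⁻¹ᵁ D).toScheme := ⟨x, hx⟩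
    have := congr($hs x')
    rw [Scheme.Hom.comp_apply] at this
    exact Eq.trans (congrArg s (Subtype.ext (morphismRestrict_base_coe φ.left D x').symm)) this
  have : IsDominant φ.left := by
    refine ⟨D.isOpen.dense hD |>.mono fun y hy ↦ ?_⟩
    obtain ⟨x, hx⟩ := (φ.left ∣_ D).surjective ⟨y, hy⟩
    exact ⟨x.1, by rw [← morphismRestrict_base_coe, hx]⟩
  have : IsSchemeTheoreticallyDominant φ.left := .of_isDominant _
  obtain ⟨h, hh⟩ := exists_comp_eq_of_constant_on_fibres φ.left D hD
    (fun V hV _ ↦ isIntegrallyClosed_of_smooth_hom S'.hom V hV) π.left fun y ↦ by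
      by_cases hy : y ∈ D
      · refine ⟨π.left (s ⟨y, hy⟩), ?_⟩
        rintro x rfl
        rw [hsD x hy]
      · obtain rfl : y = p := by simpa [D] using hy
        exact ⟨P, fun x hx ↦ hP.subset ⟨x, hx, rfl⟩⟩
  let π' : S' ⟶ C := Over.homMk h <| by
    refine ext_of_isSchemeTheoreticallyDominant φ.left ?_
    rw [reassoc_of% hh, Over.w, Over.w]
  have hπ' : φ ≫ π' = π := by ext1; exact hh
  have hvia := hμ.comp φ π' hπ'
  refine ⟨_, ⟨⟨hvia.isSemigroupLaw, C, π', _, ν, hvia⟩, ?_⟩, fun μ' ⟨_, hμ'⟩ ↦ ?_⟩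
  · rw [IsSemigroupHom, hμ.law, ← hπ', ← tensorHom_comp_tensorHom]
    simp only [Category.assoc]
  -- Uniqueness: the homomorphism condition fixes the law after precomposition with `φ ⊗ₘ φ`, which
  -- is enough by dominance.
  · have := isSchemeTheoreticallyDominant_tensorHom φ
    ext1
    refine ext_of_isSchemeTheoreticallyDominant (φ ⊗ₘ φ).left ?_
    rw [← Over.comp_left, ← Over.comp_left, ← hμ', hμ.law, ← hπ', ← tensorHom_comp_tensorHom]
    simp only [Category.assoc]
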